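/- All topological groups are Hausdorff; a t.d.l.c. group is a totally disconnected locally compact group. A topological group is compactly generated if it is generated, as an abstract group, by a compact subset. A t.d.l.c. group $G$ is regionally expansive if it has a compactly generated open subgroup $O$ which has a compact open subgroup $W$ with trivial normal core $\bigcap_{x\in O} xWx^{-1}=\{1\}$. A topological group is topologically simple if it is non-trivial and its only closed normal subgroups are $\{1\}$ and itself; it is topologically characteristically simple if it is non-trivial and its only closed subgroups that are preserved by all homeomorphic group automorphisms are $\{1\}$ and itself. A t.d.l.c. group is monolithic if the intersection of all its non-trivial closed normal subgroups is non-trivial; this intersection is then called its monolith. A t.d.l.c. group is robustly monolithic if it is monolithic and its monolith (with the subspace topology) is non-discrete, regionally expansive and topologically simple. The quasi-center of a t.d.l.c. group is the set of its elements whose centralizer is open, and a (not necessarily closed) subgroup is locally normal if its normalizer is open. A t.d.l.c. group is [A]-semisimple if its quasi-center is trivial and it has no non-trivial abelian locally normal subgroup. Let $G$ be a t.d.l.c. group. (1) If $G$ is robustly monolithic, then $G$ is regionally expansive and [A]-semisimple. (2) If $G$ is non-discrete, regionally expansive and topologically characteristically simple, then $G$ is [A]-semisimple. -/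

import Mathlib

namespace TDLC

/-- A topological group is compactly generated if it is generated, as an abstract group,
by some compact subset. -/
def CompactlyGeneratedGroup (G : Type*) [Group G] [TopologicalSpace G] : Prop :=
  ∃ K : Set G, IsCompact K ∧ Subgroup.closure K = ⊤

/-- Expansiveness of a totally disconnected locally compact group: some compact open
subgroup has trivial normal core. -/
def Expansive (G : Type*) [Group G] [TopologicalSpace G] : Prop :=
  ∃ W : Subgroup G, IsOpen (W : Set G) ∧ IsCompact (W : Set G) ∧ W.normalCore = ⊥

/-- Some compactly generated open subgroup is expansive. -/
def RegionallyExpansive (G : Type*) [Group G] [TopologicalSpace G] : Prop :=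
  ∃ O : Subgroup G, IsOpen (O : Set G) ∧ CompactlyGeneratedGroup O ∧ Expansive O

/-- The intersection of all non-trivial closed normal subgroups. -/
def monolith (G : Type*) [Group G] [TopologicalSpace G] : Subgroup G :=
  sInf {N : Subgroup G | N.Normal ∧ IsClosed (N : Set G) ∧ N ≠ ⊥}

def Monolithic (G : Type*) [Group G] [TopologicalSpace G] : Prop :=
  monolith G ≠ ⊥

def TopologicallySimple (G : Type*) [Group G] [TopologicalSpace G] : Prop :=
  Nontrivial G ∧
    ∀ N : Subgroup G, N.Normal → IsClosed (N : Set G) → N = ⊥ ∨ N = ⊤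

/-- The only closed subgroups preserved by all homeomorphic automorphisms of the group
are the trivial subgroup and the whole group, and these differ. -/
def TopologicallyCharacteristicallySimple
    (G : Type*) [Group G] [TopologicalSpace G] : Prop :=
  Nontrivial G ∧
    ∀ N : Subgroup G, IsClosed (N : Set G) →
      (∀ φ : G ≃ₜ* G, N.map (φ : G →* G) = N) → N = ⊥ ∨ N = ⊤

/-- The monolith carries the subspace topology. -/
def RobustlyMonolithic (G : Type*) [Group G] [TopologicalSpace G] : Prop :=
  Monolithic G ∧ ¬ DiscreteTopology (monolith G) ∧
    RegionallyExpansive (monolith G) ∧ TopologicallySimple (monolith G)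

/-- The quasi-center: the elements with open centralizer. -/
def quasiCenter (G : Type*) [Group G] [TopologicalSpace G] [IsTopologicalGroup G] :
    Subgroup G where
  carrier := {g | IsOpen (Subgroup.centralizer {g} : Set G)}
  one_mem' := by
    have h : Subgroup.centralizer {(1 : G)} = ⊤ := by
      ext x; simp [Subgroup.mem_centralizer_singleton_iff]
    simp [h]
  mul_mem' := by
    intro a b ha hb
    have hab : IsOpen ((Subgroup.centralizer {a} ⊓ Subgroup.centralizer {b} : Subgroup G) :
        Set G) := by
      rw [Subgroup.coe_inf]; exact ha.inter hb
    refine Subgroup.isOpen_mono ?_ hab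
    intro x hx
    obtain ⟨hxa, hxb⟩ := Subgroup.mem_inf.1 hx
    rw [Subgroup.mem_centralizer_singleton_iff] at hxa hxb ⊢
    exact (Commute.mul_right (a := x) hxa hxb)
  inv_mem' := by
    intro a ha
    refine Subgroup.isOpen_mono ?_ ha
    intro x hx
    rw [Subgroup.mem_centralizer_singleton_iff] at hx ⊢
    exact (Commute.inv_right (a := x) hx)

/-- A (not necessarily closed) subgroup is locally normal if its normalizer is open. -/
def LocallyNormal {G : Type*} [Group G] [TopologicalSpace G] (A : Subgroup G) : Prop :=
  IsOpen (Subgroup.normalizer (A : Set G) : Set G)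

/-- [A]-semisimplicity: no non-trivial locally normal abelian subgroups, and trivial
quasi-center. -/
def ASemisimple (G : Type*) [Group G] [TopologicalSpace G] [IsTopologicalGroup G] : Prop :=
  (∀ A : Subgroup G, LocallyNormal A → IsMulCommutative A → A = ⊥) ∧ quasiCenter G = ⊥

end TDLC

/-!
Throughout, `⟨S⟩` is a compactly generated open subgroup of `G` and `U` is a compact open subgroup
contained in it, such that no non-trivial subgroup of `U` is normalised by `⟨S⟩` (`CoreFree`). If
`H` is a dense subgroup, then `⟨S⟩` is contained in the group generated by `U` and finitely many
elements of `H` (`exists_finite_closure_le`). Every contradiction below is reached by exhibiting a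
non-trivial subgroup of `U` that is normalised by `U` and by such a finite set.

The quasi-centraliser of a subgroup `E` consists of the elements that centralise `E ∩ V` for some
open `V`. If `E` is non-discrete and normalised by `U`, finitely many of these elements centralise a
common `E ∩ V` normalised by `U`, so the quasi-centraliser is not dense
(`not_dense_quasiCentralizer`). For `E = G`, with `G` non-discrete and topologically
characteristically simple, this gives the triviality of the quasi-centre, which in turn implies that
non-trivial locally normal subgroups are not discrete (`LocallyNormal.inf_ne_bot`).

Let `G` be moreover topologically characteristically simple, and let `A` be a non-trivial abelian
locally normal subgroup. A compactness argument yields minimal non-trivial closed normal subgroups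
(`exists_isMinimalClosedNormal`); two distinct ones commute, so that `M · C_G(M)` is dense for each
such `M`, and `A` intersects some `M` non-trivially. After shrinking `U` and `A`, the subgroup `A`
lies in `M ∩ U` and is normalised by `U`. The conjugates of `A` generate a dense subgroup of `M`,
hence finitely many of them generate together with `U` and `C_G(M)` a group `Λ` containing `⟨S⟩`.
Taking for `V` a small open normal subgroup of `U`, let `K` be the subgroup of `A ∩ V` centralising
the intersections with `V` of these conjugates and of their `U`-conjugates. It is non-trivial
(`exists_le_forall_comm`) and normalised by `U`. Let `L` be the quasi-centraliser of `C_G(K)`.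
It contains `K`, and it is normalised by `Λ`: for `t` in one of the conjugates `B` of `A` and for
small `c ∈ C_G(K)` the commutator of `c` and `t` lies in `B ∩ V ≤ C_G(K)`. Let `U'` be an open
subgroup of `U` that is conjugated into `U` by the finitely many elements generating `⟨S⟩` modulo
`U` and `C_G(M)`, and by their inverses.

* If `L ∩ M ∩ U ≤ U'`, then `L ∩ M ∩ U` is normalised by `⟨S⟩`, and it contains `K`.
* Otherwise `L` contains some `x` in the compact set `(M ∩ U) \ U'`. The normal closure of `x` is
  dense in `M`; by compactness, `Λ` can be chosen in advance so large that, for every such `x`, the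
  `Λ`-conjugates of `x` already generate the required finitely many elements modulo `U`. These
  elements may thus be taken in `L`, so they centralise `C_G(K) ∩ V'` for some open `V'` normal in
  `U`. As `K` is abelian, `K ∩ V'` is contained in it, and `K ∩ V'` is normalised by `⟨S⟩`.

Both cases are impossible (`eq_bot_of_le_isMinimalClosedNormal`).

If `G` is robustly monolithic, all this applies to its monolith `M`. The quasi-centraliser of `M` in
`G` is then trivial (`quasiCentralizer_monolith_eq_bot`), and it contains every locally normal
subgroup of `G` that intersects `M` trivially. This transfers both properties from `M` to `G`.
-/

namespace TDLC

open Topology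

/-! ### Subgroups normalised by a given subgroup -/

section Groups

variable {G : Type*} [Group G]

/-- `W` contains no non-trivial subgroup that is normalised by `O`. For `W ≤ O` this says that
the normal core of `W` in `O` is trivial. -/
def CoreFree (O W : Subgroup G) : Prop :=
  ∀ E : Subgroup G, E ≤ W → O ≤ Subgroup.normalizer (E : Set G) → E = ⊥

theorem CoreFree.mono {O W W' : Subgroup G} (h : CoreFree O W) (hW : W' ≤ W) :
    CoreFree O W' :=
  fun E hE hO => h E (hE.trans hW) hO

theorem le_normalizer_inf {H E E' : Subgroup G} (h : H ≤ Subgroup.normalizer (E : Set G))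
    (h' : H ≤ Subgroup.normalizer (E' : Set G)) :
    H ≤ Subgroup.normalizer ((E ⊓ E' : Subgroup G) : Set G) := by
  rw [Subgroup.le_normalizer_iff] at *
  exact fun g hg e he => ⟨h g hg e he.1, h' g hg e he.2⟩

theorem mem_normalizer_of_forall_comm {E : Subgroup G} {g : G} (h : ∀ e ∈ E, g * e = e * g) :
    g ∈ Subgroup.normalizer (E : Set G) :=
  Subgroup.centralizer_le_normalizer E
    (Subgroup.mem_centralizer_iff.2 fun e he => (h e he).symm)

/-- If conjugation by the elements of `F` and their inverses sends `U'` into `U`, then a subgroup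
`N` normalised by `U` and `F` with `N ∩ U ≤ U'` has an intersection with `U` which is still
normalised by `F`. -/
theorem sup_closure_le_normalizer_inf {U U' N : Subgroup G} {F : Set G}
    (hF : ∀ f ∈ F, ∀ u ∈ U', f * u * f⁻¹ ∈ U ∧ f⁻¹ * u * f ∈ U)
    (hUN : U ≤ Subgroup.normalizer (N : Set G)) (hFN : F ⊆ Subgroup.normalizer (N : Set G))
    (hN : N ⊓ U ≤ U') :
    U ⊔ Subgroup.closure F ≤ Subgroup.normalizer ((N ⊓ U : Subgroup G) : Set G) := by
  refine sup_le (le_normalizer_inf hUN Subgroup.le_normalizer) ((Subgroup.closure_le _).2 ?_)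
  intro f hf
  refine Subgroup.mem_normalizer_iff.2 fun x => ⟨fun hx => ?_, fun hx => ?_⟩
  · exact ⟨(Subgroup.mem_normalizer_iff.1 (hFN hf) x).1 hx.1, (hF f hf x (hN hx)).1⟩
  · refine ⟨(Subgroup.mem_normalizer_iff.1 (hFN hf) x).2 hx.1, ?_⟩
    simpa [mul_assoc] using (hF f hf _ (hN hx)).2

/-- Given finitely many abelian subgroups normalised by `V`, every non-trivial normal subgroup
`E` of `V` contains a non-trivial normal subgroup of `V` that centralises their intersections
with `V`. For a single abelian subgroup `B`: either `E` centralises `B ∩ V`, or `E ∩ B`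
contains a non-trivial commutator and centralises `B`. -/
theorem exists_le_forall_comm {V : Subgroup G} {𝒜 : Set (Subgroup G)} (h𝒜 : 𝒜.Finite)
    (hV : ∀ B ∈ 𝒜, V ≤ Subgroup.normalizer (B : Set G))
    (hcomm : ∀ B ∈ 𝒜, ∀ a ∈ B, ∀ b ∈ B, a * b = b * a)
    {E : Subgroup G} (hEV : E ≤ V) (hVE : V ≤ Subgroup.normalizer (E : Set G)) (hE : E ≠ ⊥) :
    ∃ K ≤ E, K ≠ ⊥ ∧ V ≤ Subgroup.normalizer (K : Set G) ∧
      ∀ B ∈ 𝒜, ∀ b ∈ B, b ∈ V → ∀ k ∈ K, k * b = b * k := by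
  induction 𝒜, h𝒜 using Set.Finite.induction_on with
  | empty => exact ⟨E, le_rfl, hE, hVE, by simp⟩
  | @insert B s _ _ ih =>
    obtain ⟨K, hKE, hK, hVK, hKs⟩ := ih (fun B hB => hV B (Set.mem_insert_of_mem _ hB))
      (fun B hB => hcomm B (Set.mem_insert_of_mem _ hB))
    by_cases h : ∀ b ∈ B, b ∈ V → ∀ k ∈ K, k * b = b * k
    · refine ⟨K, hKE, hK, hVK, ?_⟩
      rintro B' (rfl | hB')
      · exact h
      · exact hKs B' hB'
    · push Not at h
      obtain ⟨b, hb, hbV, k, hk, hkb⟩ := h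
      have hVB := hV B (Set.mem_insert _ _)
      refine ⟨K ⊓ B, inf_le_left.trans hKE, ?_, le_normalizer_inf hVK hVB, ?_⟩
      · intro hbot
        have h1 : k * b * k⁻¹ * b⁻¹ ∈ K ⊓ B := by
          refine ⟨?_, B.mul_mem ((Subgroup.le_normalizer_iff.1 hVB) k (hEV (hKE hk)) b hb)
            (B.inv_mem hb)⟩
          have := K.mul_mem hk ((Subgroup.le_normalizer_iff.1 hVK) b hbV _ (K.inv_mem hk))
          simpa [mul_assoc] using this
        rw [hbot, Subgroup.mem_bot, mul_inv_eq_one, mul_inv_eq_iff_eq_mul] at h1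
        exact hkb h1
      · rintro B' (rfl | hB') c hc hcV x hx
        · exact hcomm B' (Set.mem_insert _ _) x hx.2 c hc
        · exact hKs B' hB' c hc hcV x hx.1

end Groups

/-! ### Compactly generated and compact open subgroups -/

section TopologicalGroups

variable {G : Type*} [Group G] [TopologicalSpace G]

/-- Regional expansiveness, expressed with subgroups of `G` only. -/
theorem RegionallyExpansive.exists_coreFree [IsTopologicalGroup G] (h : RegionallyExpansive G) :
    ∃ (S : Set G) (W : Subgroup G), IsCompact S ∧ IsOpen (W : Set G) ∧ IsCompact (W : Set G) ∧
      W ≤ Subgroup.closure S ∧ CoreFree (Subgroup.closure S) W := by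
  obtain ⟨O, hO, ⟨S, hS, hSO⟩, W, hWo, hWc, hW⟩ := h
  have hcl : Subgroup.closure ((↑) '' S : Set G) = O := by
    have := congrArg (Subgroup.map O.subtype) hSO
    rw [MonoidHom.map_closure] at this
    simpa [← MonoidHom.range_eq_map] using this
  refine ⟨(↑) '' S, W.map O.subtype, hS.image continuous_subtype_val, ?_, ?_, ?_, ?_⟩
  · exact hO.isOpenMap_subtype_val _ hWo
  · exact hWc.image continuous_subtype_val
  · rw [hcl]
    exact Subgroup.map_subtype_le W
  · rw [hcl]
    intro E hEW hE
    have hEO : E ≤ O := hEW.trans (Subgroup.map_subtype_le W)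
    have hn : (E.subgroupOf O).Normal := ⟨fun e he o => by
      have := (Subgroup.le_normalizer_iff.1 hE) o o.2 e he
      simpa [Subgroup.mem_subgroupOf] using this⟩
    have hle : E.subgroupOf O ≤ W := by
      intro e he
      obtain ⟨w, hw, hwe⟩ := hEW (Subgroup.mem_subgroupOf.1 he)
      have : w = e := Subtype.ext hwe
      exact this ▸ hw
    have hbot : E.subgroupOf O = ⊥ := by
      have := (Subgroup.normal_le_normalCore (H := W) (N := E.subgroupOf O)).2 hle
      rwa [hW, le_bot_iff] at this
    rw [Subgroup.subgroupOf_eq_bot, disjoint_iff, inf_eq_left.2 hEO] at hbot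
    exact hbot

theorem regionallyExpansive_of_coreFree [IsTopologicalGroup G] {S : Set G} {W : Subgroup G}
    (hS : IsCompact S) (hWo : IsOpen (W : Set G)) (hWc : IsCompact (W : Set G))
    (hWS : W ≤ Subgroup.closure S) (h : CoreFree (Subgroup.closure S) W) :
    RegionallyExpansive G := by
  set O := Subgroup.closure S with hO
  have hOo : IsOpen (O : Set G) := Subgroup.isOpen_mono hWS hWo
  have hSO : S ⊆ Set.range ((↑) : O → G) := by
    rw [Subtype.range_coe]
    exact Subgroup.subset_closure
  refine ⟨O, hOo, ⟨(↑) ⁻¹' S, ?_, ?_⟩, W.subgroupOf O, ?_, ?_, ?_⟩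
  · exact (IsInducing.subtypeVal.isCompact_preimage_iff hSO).2 hS
  · exact Subgroup.closure_closure_coe_preimage
  · exact hWo.preimage continuous_subtype_val
  · refine (IsInducing.subtypeVal.isCompact_preimage_iff ?_).2 hWc
    rw [Subtype.range_coe]
    exact hWS
  · have key := h ((W.subgroupOf O).normalCore.map O.subtype) ?_ ?_
    · exact (Subgroup.map_eq_bot_iff_of_injective _ O.subtype_injective).1 key
    · rintro _ ⟨w, hw, rfl⟩
      exact Subgroup.mem_subgroupOf.1 (Subgroup.normalCore_le _ hw)
    · rw [Subgroup.le_normalizer_iff]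
      rintro o ho _ ⟨w, hw, rfl⟩
      exact ⟨⟨o, ho⟩ * w * ⟨o, ho⟩⁻¹, (Subgroup.normalCore_normal _).conj_mem w hw ⟨o, ho⟩, rfl⟩

/-- A compactly generated subgroup lies in the subgroup generated by a given open subgroup and
finitely many elements of a given dense subgroup. -/
theorem exists_finite_closure_le [IsTopologicalGroup G] {S : Set G} (hS : IsCompact S)
    {U : Subgroup G} (hU : IsOpen (U : Set G)) {H : Subgroup G} (hH : Dense (H : Set G)) :
    ∃ F : Set G, F.Finite ∧ F ⊆ H ∧ Subgroup.closure S ≤ U ⊔ Subgroup.closure F := by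
  have hopen : ∀ h : H, IsOpen ((fun g : G => (h : G)⁻¹ * g) ⁻¹' (U : Set G)) :=
    fun h => hU.preimage (continuous_const_mul _)
  have hcov : S ⊆ ⋃ h : H, (fun g : G => (h : G)⁻¹ * g) ⁻¹' (U : Set G) := by
    intro s _
    have hne : ((fun g : G => g⁻¹ * s) ⁻¹' (U : Set G)).Nonempty := ⟨s, by simp⟩
    obtain ⟨g, hg, hgH⟩ := hH.inter_open_nonempty _
      (hU.preimage (continuous_inv.mul continuous_const)) hne
    exact Set.mem_iUnion.2 ⟨⟨g, hgH⟩, hg⟩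
  obtain ⟨t, ht⟩ := hS.elim_finite_subcover _ hopen hcov
  refine ⟨(fun h : H => (h : G)) '' (t : Set H), t.finite_toSet.image _, ?_, ?_⟩
  · rintro _ ⟨h, _, rfl⟩
    exact h.2
  · rw [Subgroup.closure_le]
    intro s hs
    obtain ⟨h, hht, hsU⟩ := Set.mem_iUnion₂.1 (ht hs)
    have hh : (h : G) ∈ U ⊔ Subgroup.closure ((fun h : H => (h : G)) '' (t : Set H)) :=
      Subgroup.mem_sup_right (Subgroup.subset_closure ⟨h, hht, rfl⟩)
    have := mul_mem hh (Subgroup.mem_sup_left (T := Subgroup.closure _) hsU)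
    simpa using this

/-- An element of the closure of `H` is a product of an element of `H` and an element of any
given open subgroup. -/
theorem exists_inv_mul_mem [IsTopologicalGroup G] {H U : Subgroup G} (hU : IsOpen (U : Set G))
    {g : G} (hg : g ∈ closure (H : Set G)) : ∃ h ∈ H, h⁻¹ * g ∈ U := by
  obtain ⟨h, hh, hhH⟩ := mem_closure_iff.1 hg ((fun x : G => x⁻¹ * g) ⁻¹' (U : Set G))
    (hU.preimage (continuous_inv.mul continuous_const)) (by simp)
  exact ⟨h, hhH, hh⟩

/-- A compact subgroup `U` normalises arbitrarily small open subgroups. -/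
theorem exists_isOpen_le_normalizer [IsTopologicalGroup G] {U V : Subgroup G}
    (hU : IsCompact (U : Set G)) (hUo : IsOpen (U : Set G)) (hV : IsOpen (V : Set G)) :
    ∃ V' : Subgroup G, IsOpen (V' : Set G) ∧ V' ≤ V ∧ V' ≤ U ∧
      U ≤ Subgroup.normalizer (V' : Set G) := by
  let V' : Subgroup G :=
    { carrier := {v | v ∈ U ∧ ∀ u ∈ U, u * v * u⁻¹ ∈ V}
      one_mem' := ⟨one_mem U, fun u _ => by simp⟩
      mul_mem' := fun {a b} ha hb => ⟨mul_mem ha.1 hb.1, fun u hu => by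
        simpa [mul_assoc] using mul_mem (ha.2 u hu) (hb.2 u hu)⟩
      inv_mem' := fun {a} ha => ⟨inv_mem ha.1, fun u hu => by
        simpa [mul_assoc] using inv_mem (ha.2 u hu)⟩ }
  have hnhds : ∀ᶠ v in 𝓝 (1 : G), ∀ u ∈ (U : Set G), u * v * u⁻¹ ∈ V := by
    refine hU.eventually_forall_of_forall_eventually fun u _ => ?_
    have hc : Continuous fun z : G × G => z.2 * z.1 * z.2⁻¹ := by fun_prop
    exact hc.continuousAt.eventually_mem (hV.mem_nhds (by simp))
  refine ⟨V', ?_, fun v hv => by simpa using hv.2 1 (one_mem U), fun v hv => hv.1, ?_⟩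
  · refine Subgroup.isOpen_of_mem_nhds V' (g := 1) ?_
    filter_upwards [hnhds, hUo.mem_nhds (one_mem U)] with v h1 h2 using ⟨h2, h1⟩
  · rw [Subgroup.le_normalizer_iff]
    refine fun u hu v hv => ⟨mul_mem (mul_mem hu hv.1) (inv_mem hu), fun w hw => ?_⟩
    simpa [mul_assoc] using hv.2 (w * u) (mul_mem hw hu)

/-- Van Dantzig: compact open subgroups form a neighbourhood basis of the identity. -/
theorem exists_compact_open_subgroup [IsTopologicalGroup G] [T2Space G] [LocallyCompactSpace G]
    [TotallyDisconnectedSpace G] {T : Set G} (hT : T ∈ 𝓝 (1 : G)) :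
    ∃ U : Subgroup G, IsOpen (U : Set G) ∧ IsCompact (U : Set G) ∧ (U : Set G) ⊆ T := by
  obtain ⟨K, hK, hKT, hKc⟩ := LocallyCompactSpace.local_compact_nhds 1 T hT
  obtain ⟨C, hC, h1C, hCK⟩ := loc_compact_Haus_tot_disc_of_zero_dim.mem_nhds_iff.1 hK
  have hCc : IsCompact C := hKc.of_isClosed_subset hC.1 hCK
  -- The stabiliser of the compact clopen set `C ∋ 1` under left translation is open, and it
  -- lies in `C`.
  let U : Subgroup G :=
    { carrier := {g | ∀ c ∈ C, g * c ∈ C ∧ g⁻¹ * c ∈ C}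
      one_mem' := fun c hc => by simpa using hc
      mul_mem' := fun {a b} ha hb c hc => by
        refine ⟨?_, ?_⟩
        · rw [mul_assoc]
          exact (ha _ (hb c hc).1).1
        · rw [mul_inv_rev, mul_assoc]
          exact (hb _ (ha c hc).2).2
      inv_mem' := fun {a} ha c hc => by
        rw [inv_inv]
        exact (ha c hc).symm }
  have hUC : (U : Set G) ⊆ C := fun g hg => by simpa using (hg 1 h1C).1
  have hUo : IsOpen (U : Set G) := by
    have hnhds : ∀ᶠ g in 𝓝 (1 : G), ∀ c ∈ C, g * c ∈ C ∧ g⁻¹ * c ∈ C := by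
      refine hCc.eventually_forall_of_forall_eventually fun c hc => ?_
      have h1 : Continuous fun z : G × G => z.1 * z.2 := by fun_prop
      have h2 : Continuous fun z : G × G => z.1⁻¹ * z.2 := by fun_prop
      exact (h1.continuousAt.eventually_mem (hC.2.mem_nhds (by simpa using hc))).and
        (h2.continuousAt.eventually_mem (hC.2.mem_nhds (by simpa using hc)))
    exact Subgroup.isOpen_of_mem_nhds U (g := 1) hnhds
  exact ⟨U, hUo, hCc.of_isClosed_subset (Subgroup.isClosed_of_isOpen U hUo) hUC,
    hUC.trans (hCK.trans hKT)⟩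

end TopologicalGroups

/-! ### Quasi-centralisers and locally normal subgroups -/

section QuasiCentralizer

variable {G : Type*} [Group G] [TopologicalSpace G]

/-- The quasi-centraliser of `E`: the elements that centralise `E ∩ V` for some open subgroup `V`
of the ambient group. -/
def quasiCentralizer (E : Subgroup G) : Subgroup G where
  carrier := {g | ∃ V : Subgroup G, IsOpen (V : Set G) ∧ ∀ e ∈ E, e ∈ V → g * e = e * g}
  one_mem' := ⟨⊤, isOpen_univ, fun e _ _ => by simp⟩
  mul_mem' := by
    rintro a b ⟨V, hV, ha⟩ ⟨V', hV', hb⟩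
    refine ⟨V ⊓ V', hV.inter hV', fun e he hev => ?_⟩
    rw [mul_assoc, hb e he hev.2, ← mul_assoc, ha e he hev.1, mul_assoc]
  inv_mem' := by
    rintro a ⟨V, hV, ha⟩
    exact ⟨V, hV, fun e he hev => (show Commute a e from ha e he hev).inv_left⟩

theorem quasiCenter_le_quasiCentralizer [IsTopologicalGroup G] (E : Subgroup G) :
    quasiCenter G ≤ quasiCentralizer E :=
  fun g hg => ⟨Subgroup.centralizer {g}, hg, fun _ _ he =>
    (Subgroup.mem_centralizer_singleton_iff.1 he).symm⟩

theorem quasiCentralizer_top [IsTopologicalGroup G] :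
    quasiCentralizer (⊤ : Subgroup G) = quasiCenter G := by
  refine le_antisymm ?_ (quasiCenter_le_quasiCentralizer ⊤)
  rintro g ⟨V, hV, hg⟩
  exact Subgroup.isOpen_mono (fun v hv => Subgroup.mem_centralizer_singleton_iff.2
    (hg v (Subgroup.mem_top v) hv).symm) hV

theorem map_quasiCentralizer_le [IsTopologicalGroup G] (E : Subgroup G) (φ : G ≃ₜ* G) :
    (quasiCentralizer E).map (φ : G →* G) ≤ quasiCentralizer (E.map (φ : G →* G)) := by
  rintro _ ⟨g, ⟨V, hV, hg⟩, rfl⟩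
  refine ⟨V.map (φ : G →* G), φ.toHomeomorph.isOpenMap _ hV, ?_⟩
  rintro _ ⟨e, he, rfl⟩ ⟨v, hv, hve⟩
  have : v = e := φ.injective hve
  subst this
  simpa using congrArg φ (hg v he hv)

/-- Finitely many elements that quasi-centralise `E` centralise a common intersection `E ∩ V`
with `V` open. -/
theorem exists_isOpen_forall_comm {E : Subgroup G} {F : Set G} (hF : F.Finite)
    (hFE : F ⊆ quasiCentralizer E) :
    ∃ V : Subgroup G, IsOpen (V : Set G) ∧ ∀ f ∈ F, ∀ e ∈ E, e ∈ V → f * e = e * f := by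
  induction F, hF using Set.Finite.induction_on with
  | empty => exact ⟨⊤, isOpen_univ, by simp⟩
  | @insert a s _ _ ih =>
    obtain ⟨V, hV, h⟩ := ih fun x hx => hFE (Set.mem_insert_of_mem _ hx)
    obtain ⟨V', hV', h'⟩ := hFE (Set.mem_insert a s)
    refine ⟨V ⊓ V', hV.inter hV', ?_⟩
    rintro f (rfl | hf) e he hev
    · exact h' e he hev.2
    · exact h f hf e he hev.1

/-- If the locally normal subgroup `A` and the normal subgroup `M` intersect trivially, then `A`
quasi-centralises `M`: the commutators of `A` with `M ∩ N_G(A)` lie in `A ∩ M`. -/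
theorem le_quasiCentralizer_of_inf_eq_bot {A M : Subgroup G} (hA : LocallyNormal A) [M.Normal]
    (h : A ⊓ M = ⊥) : A ≤ quasiCentralizer M := by
  intro a ha
  refine ⟨_, hA, fun m hm hmA => ?_⟩
  have h1 : a * m * a⁻¹ * m⁻¹ ∈ A ⊓ M := by
    refine ⟨?_, M.mul_mem (‹M.Normal›.conj_mem m hm a) (M.inv_mem hm)⟩
    have := A.mul_mem ha ((Subgroup.mem_normalizer_iff.1 hmA a⁻¹).1 (A.inv_mem ha))
    simpa [mul_assoc] using this
  rw [h, Subgroup.mem_bot, mul_inv_eq_one, mul_inv_eq_iff_eq_mul] at h1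
  exact h1

variable [IsTopologicalGroup G]

/-- When the quasi-centre is trivial, a non-trivial locally normal subgroup is not discrete: an
element `e` of `E` outside the identity is moved by arbitrarily small elements of the
normaliser, and the commutators so obtained are small elements of `E`. -/
theorem LocallyNormal.inf_ne_bot {E V : Subgroup G} (hQ : quasiCenter G = ⊥)
    (hE : LocallyNormal E) (hE1 : E ≠ ⊥) (hV : IsOpen (V : Set G)) : E ⊓ V ≠ ⊥ := by
  intro h
  refine hE1 ((Subgroup.eq_bot_iff_forall E).2 fun e he => ?_)
  rw [← Subgroup.mem_bot, ← hQ]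
  refine Subgroup.isOpen_of_mem_nhds (Subgroup.centralizer {e}) (g := 1) ?_
  have hc : Continuous fun v : G => v * e * v⁻¹ * e⁻¹ := by fun_prop
  filter_upwards [hE.mem_nhds (one_mem _), hc.continuousAt.eventually_mem
    (hV.mem_nhds (by simp : (1 : G) * e * 1⁻¹ * e⁻¹ ∈ (V : Set G)))] with v hvE hvV
  have h1 : v * e * v⁻¹ * e⁻¹ ∈ E ⊓ V :=
    ⟨E.mul_mem ((Subgroup.mem_normalizer_iff.1 hvE e).1 he) (E.inv_mem he), hvV⟩
  rw [h, Subgroup.mem_bot, mul_inv_eq_one, mul_inv_eq_iff_eq_mul] at h1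
  exact Subgroup.mem_centralizer_singleton_iff.2 h1

theorem LocallyNormal.of_le {E U : Subgroup G} (hU : IsOpen (U : Set G))
    (h : U ≤ Subgroup.normalizer (E : Set G)) : LocallyNormal E :=
  Subgroup.isOpen_mono h hU

/-- In a regionally expansive group, a non-discrete subgroup normalised by the compact open
subgroup `U` does not have a dense quasi-centraliser. Otherwise the group `⟨S⟩` is contained in
the group generated by `U` and finitely many elements centralising `E ∩ V` for some open `V`
normal in `U`, so that `E ∩ V` is normalised by `⟨S⟩`. -/
theorem not_dense_quasiCentralizer {S : Set G} {U E : Subgroup G} (hS : IsCompact S)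
    (hUo : IsOpen (U : Set G)) (hUc : IsCompact (U : Set G))
    (hcore : CoreFree (Subgroup.closure S) U) (hE : U ≤ Subgroup.normalizer (E : Set G))
    (hEV : ∀ V : Subgroup G, IsOpen (V : Set G) → E ⊓ V ≠ ⊥) :
    ¬ Dense (quasiCentralizer E : Set G) := by
  intro hd
  obtain ⟨F, hF, hFE, hle⟩ := exists_finite_closure_le hS hUo hd
  obtain ⟨V, hV, hVF⟩ := exists_isOpen_forall_comm hF hFE
  obtain ⟨V', hV', hV'V, hV'U, hUV'⟩ := exists_isOpen_le_normalizer hUc hUo hV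
  refine hEV V' hV' (hcore _ (inf_le_right.trans hV'U) (hle.trans (sup_le ?_ ?_)))
  · exact le_normalizer_inf hE hUV'
  · rw [Subgroup.closure_le]
    exact fun f hf => mem_normalizer_of_forall_comm fun e he => hVF f hf e he.1 (hV'V he.2)

end QuasiCentralizer

/-! ### Minimal closed normal subgroups -/

section Escape

variable {G : Type*} [Group G] [TopologicalSpace G] [IsTopologicalGroup G]

theorem exists_isOpen_forall_conj_mem {U : Subgroup G} (hU : IsOpen (U : Set G)) {F : Set G}
    (hF : F.Finite) :
    ∃ U' : Subgroup G, IsOpen (U' : Set G) ∧ U' ≤ U ∧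
      ∀ f ∈ F, ∀ u ∈ U', f * u * f⁻¹ ∈ U ∧ f⁻¹ * u * f ∈ U := by
  induction F, hF using Set.Finite.induction_on with
  | empty => exact ⟨U, hU, le_rfl, by simp⟩
  | @insert a s _ _ ih =>
    obtain ⟨U', hU', hle, h⟩ := ih
    let P := U.comap (MulAut.conj a).toMonoidHom ⊓ U.comap (MulAut.conj a⁻¹).toMonoidHom
    have hP : IsOpen (P : Set G) := by
      refine IsOpen.inter (hU.preimage ?_) (hU.preimage ?_)
      · change Continuous fun u : G => a * u * a⁻¹
        fun_prop
      · change Continuous fun u : G => a⁻¹ * u * a⁻¹⁻¹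
        fun_prop
    refine ⟨U' ⊓ P, hU'.inter hP, inf_le_left.trans hle, ?_⟩
    rintro f (rfl | hf) u ⟨hu, hu1, hu2⟩
    · exact ⟨by simpa using hu1, by simpa using hu2⟩
    · exact h f hf u hu

end Escape

section MinimalNormal

variable {G : Type*} [Group G] [TopologicalSpace G]

/-- `M` is minimal among the non-trivial closed normal subgroups. -/
def IsMinimalClosedNormal (M : Subgroup G) : Prop :=
  Minimal (fun N : Subgroup G => N.Normal ∧ IsClosed (N : Set G) ∧ N ≠ ⊥) M

theorem IsMinimalClosedNormal.eq_of_le {M N : Subgroup G} (hM : IsMinimalClosedNormal M)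
    (hN : N.Normal) (hNc : IsClosed (N : Set G)) (hN1 : N ≠ ⊥) (h : N ≤ M) : N = M :=
  le_antisymm h (hM.2 ⟨hN, hNc, hN1⟩ h)

theorem isClosed_map_continuousMulEquiv {N : Subgroup G} (hN : IsClosed (N : Set G))
    (φ : G ≃ₜ* G) : IsClosed ((N.map (φ : G →* G) : Subgroup G) : Set G) :=
  φ.toHomeomorph.isClosedMap _ hN

theorem IsMinimalClosedNormal.map {M : Subgroup G} (hM : IsMinimalClosedNormal M)
    (φ : G ≃ₜ* G) : IsMinimalClosedNormal (M.map (φ : G →* G)) := by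
  have hne : ∀ (ψ : G ≃ₜ* G) {N : Subgroup G}, N ≠ ⊥ → N.map (ψ : G →* G) ≠ ⊥ :=
    fun ψ N hN h => hN ((Subgroup.map_eq_bot_iff_of_injective N ψ.injective).1 h)
  have hnorm : ∀ (ψ : G ≃ₜ* G) {N : Subgroup G}, N.Normal → (N.map (ψ : G →* G)).Normal :=
    fun ψ N hN => hN.map _ ψ.surjective
  refine ⟨⟨hnorm φ hM.1.1, isClosed_map_continuousMulEquiv hM.1.2.1 φ, hne φ hM.1.2.2⟩, ?_⟩
  rintro N ⟨hN, hNc, hN1⟩ hle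
  have hle' : N.map (φ.symm : G →* G) ≤ M := by
    rintro _ ⟨n, hn, rfl⟩
    obtain ⟨m, hm, rfl⟩ := hle hn
    simpa using hm
  have heq := hM.eq_of_le (hnorm φ.symm hN) (isClosed_map_continuousMulEquiv hNc φ.symm)
    (hne φ.symm hN1) hle'
  rw [← heq]
  rintro _ ⟨_, ⟨n, hn, rfl⟩, rfl⟩
  simpa using hn

theorem IsMinimalClosedNormal.topologicalClosure_eq [IsTopologicalGroup G] {M N : Subgroup G}
    (hM : IsMinimalClosedNormal M) [N.Normal] (hN1 : N ≠ ⊥) (h : N ≤ M) :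
    N.topologicalClosure = M :=
  hM.eq_of_le (Subgroup.is_normal_topologicalClosure N) N.isClosed_topologicalClosure
    (fun hb => hN1 (le_bot_iff.1 (hb ▸ N.le_topologicalClosure)))
    (N.topologicalClosure_minimal h hM.1.2.1)

/-- Distinct minimal closed normal subgroups intersect trivially, hence commute. -/
theorem IsMinimalClosedNormal.le_sup_centralizer {M N : Subgroup G}
    (hM : IsMinimalClosedNormal M) (hN : IsMinimalClosedNormal N) :
    N ≤ M ⊔ Subgroup.centralizer (M : Set G) := by
  have hMn := hM.1.1
  have hNn := hN.1.1
  have hI : IsClosed ((M ⊓ N : Subgroup G) : Set G) := hM.1.2.1.inter hN.1.2.1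
  by_cases h : M ⊓ N = ⊥
  · refine le_sup_of_le_right fun n hn => Subgroup.mem_centralizer_iff.2 fun m hm => ?_
    exact Subgroup.commute_of_normal_of_disjoint M N hMn hNn (disjoint_iff.2 h) m n hm hn
  · have h1 := hM.eq_of_le inferInstance hI h inf_le_left
    have h2 := hN.eq_of_le inferInstance hI h inf_le_right
    exact le_sup_of_le_left (h2.symm.trans h1).le

/-- In a regionally expansive group with trivial quasi-centre there is a minimal non-trivial closed
normal subgroup: for some open `U' ≤ U`, every non-trivial closed normal subgroup meets the
compact set `U \ U'`, so that a chain of them has a non-trivial intersection. -/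
theorem exists_isMinimalClosedNormal [IsTopologicalGroup G] {S : Set G} {U : Subgroup G}
    (hS : IsCompact S) (hUo : IsOpen (U : Set G)) (hUc : IsCompact (U : Set G))
    (hcore : CoreFree (Subgroup.closure S) U) (hQ : quasiCenter G = ⊥) [T2Space G]
    [Nontrivial G] : ∃ M : Subgroup G, IsMinimalClosedNormal M := by
  have hd : Dense ((⊤ : Subgroup G) : Set G) := by simp
  obtain ⟨F, hF, -, hle⟩ := exists_finite_closure_le hS hUo hd
  obtain ⟨U', hU'o, -, hU'⟩ := exists_isOpen_forall_conj_mem hUo hF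
  have hX : IsCompact ((U : Set G) \ U') := hUc.diff hU'o
  have hmeet : ∀ N : Subgroup G, N.Normal → N ≠ ⊥ →
      ((N : Set G) ∩ ((U : Set G) \ U')).Nonempty := by
    intro N hN hN1
    by_contra hne
    have hNU : N ⊓ U ≤ U' := fun x hx => by
      by_contra hxU
      exact hne ⟨x, hx.1, hx.2, hxU⟩
    have hnorm : Subgroup.normalizer (N : Set G) = ⊤ := Subgroup.normalizer_eq_top N
    have hE : LocallyNormal N := by
      simp [LocallyNormal, hnorm]
    refine hE.inf_ne_bot hQ hN1 hUo (hcore _ inf_le_right (hle.trans ?_))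
    exact sup_closure_le_normalizer_inf hU' (by simp [hnorm]) (by simp [hnorm]) hNU
  let 𝒩 : Set (Subgroup G) := {N | N.Normal ∧ IsClosed (N : Set G) ∧ N ≠ ⊥}
  have hchain : ∀ c ⊆ 𝒩, IsChain (· ≤ ·) c → ∀ y ∈ c, ∃ lb ∈ 𝒩, ∀ z ∈ c, lb ≤ z := by
    intro c hc hch y hy
    have hne : Nonempty c := ⟨⟨y, hy⟩⟩
    have hdir : Directed (· ⊇ ·) fun N : c => ((N : Subgroup G) : Set G) ∩ ((U : Set G) \ U') := by
      intro N N'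
      rcases hch.total N.2 N'.2 with h | h
      · exact ⟨N, subset_rfl, Set.inter_subset_inter_left _ h⟩
      · exact ⟨N', Set.inter_subset_inter_left _ h, subset_rfl⟩
    have hcl : ∀ N : c, IsClosed (((N : Subgroup G) : Set G) ∩ ((U : Set G) \ U')) :=
      fun N => (hc N.2).2.1.inter hX.isClosed
    obtain ⟨x, hx⟩ := IsCompact.nonempty_iInter_of_directed_nonempty_isCompact_isClosed _ hdir
      (fun N => hmeet N (hc N.2).1 (hc N.2).2.2)
      (fun N => hX.of_isClosed_subset (hcl N) Set.inter_subset_right) hcl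
    rw [Set.mem_iInter] at hx
    refine ⟨sInf c, ⟨⟨?_⟩, ?_, ?_⟩, fun z hz => sInf_le hz⟩
    · intro n hn g
      rw [Subgroup.mem_sInf] at hn ⊢
      exact fun N hN => (hc hN).1.conj_mem n (hn N hN) g
    · rw [Subgroup.coe_sInf]
      exact isClosed_biInter fun N hN => (hc hN).2.1
    · intro hbot
      have hx1 : x ∈ sInf c := Subgroup.mem_sInf.2 fun N hN => (hx ⟨N, hN⟩).1
      rw [hbot, Subgroup.mem_bot] at hx1
      exact (hx ⟨y, hy⟩).2.2 (hx1 ▸ one_mem U')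
  obtain ⟨M, -, hM⟩ := zorn_le_nonempty₀ (α := (Subgroup G)ᵒᵈ) 𝒩
    (fun c hc hch y hy => hchain c hc hch.symm y hy) (OrderDual.toDual ⊤)
    (show (⊤ : Subgroup G) ∈ 𝒩 from ⟨inferInstance, by simp, top_ne_bot⟩)
  exact ⟨M, hM⟩

end MinimalNormal

/-! ### Conjugates of locally normal subgroups -/

section Conjugates

variable {G : Type*} [Group G] [TopologicalSpace G] [IsTopologicalGroup G]

theorem LocallyNormal.map_conj {B : Subgroup G} (hB : LocallyNormal B) (g : G) :
    LocallyNormal (B.map (MulAut.conj g).toMonoidHom) := by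
  refine Subgroup.isOpen_mono
    (H₁ := (Subgroup.normalizer (B : Set G)).comap (MulAut.conj g⁻¹).toMonoidHom) ?_ ?_
  · rw [Subgroup.le_normalizer_iff]
    rintro h hh _ ⟨b, hb, rfl⟩
    refine ⟨g⁻¹ * h * g * b * (g⁻¹ * h * g)⁻¹, ?_, by simp [mul_assoc]⟩
    refine (Subgroup.mem_normalizer_iff.1 ?_ b).1 hb
    simpa using hh
  · refine hB.preimage ?_
    change Continuous fun u : G => g⁻¹ * u * g⁻¹⁻¹
    fun_prop

/-- A locally normal subgroup has finitely many conjugates under a compact subgroup. -/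
theorem LocallyNormal.finite_conj {U B : Subgroup G} (hB : LocallyNormal B)
    (hU : IsCompact (U : Set G)) :
    ((fun u : G => B.map (MulAut.conj u).toMonoidHom) '' (U : Set G)).Finite := by
  have hopen : ∀ u : G, IsOpen ((fun g : G => u⁻¹ * g) ⁻¹' (Subgroup.normalizer (B : Set G))) :=
    fun u => hB.preimage (continuous_const_mul _)
  obtain ⟨t, ht⟩ := hU.elim_finite_subcover _ hopen
    fun u _ => Set.mem_iUnion.2 ⟨u, by simp⟩
  refine (t.finite_toSet.image fun u : G => B.map (MulAut.conj u).toMonoidHom).subset ?_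
  rintro _ ⟨u, hu, rfl⟩
  obtain ⟨v, hv, huv⟩ := Set.mem_iUnion₂.1 (ht hu)
  refine ⟨v, hv, ?_⟩
  have h1 : B.map (MulAut.conj (v⁻¹ * u)).toMonoidHom = B :=
    Subgroup.mem_normalizer_iff_map_conj_eq.1 huv
  calc B.map (MulAut.conj v).toMonoidHom
      = (B.map (MulAut.conj (v⁻¹ * u)).toMonoidHom).map (MulAut.conj v).toMonoidHom := by rw [h1]
    _ = B.map (MulAut.conj u).toMonoidHom := by
        rw [Subgroup.map_map]
        congr 1
        ext x
        simp [mul_assoc]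

/-- If conjugation by `t⁻¹` sends `C ∩ V` into `C` for some open `V`, then conjugation by `t`
preserves the quasi-centraliser of `C`. -/
theorem conj_mem_quasiCentralizer {C V : Subgroup G} {t g : G} (hV : IsOpen (V : Set G))
    (ht : ∀ c ∈ C, c ∈ V → t⁻¹ * c * t ∈ C) (hg : g ∈ quasiCentralizer C) :
    t * g * t⁻¹ ∈ quasiCentralizer C := by
  obtain ⟨V', hV', hgV'⟩ := hg
  refine ⟨V ⊓ V'.comap (MulAut.conj t⁻¹).toMonoidHom, hV.inter (hV'.preimage ?_), ?_⟩
  · change Continuous fun u : G => t⁻¹ * u * t⁻¹⁻¹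
    fun_prop
  · rintro c hc ⟨hcV, hcV'⟩
    have h1 := hgV' _ (ht c hc hcV) (by simpa using hcV')
    calc t * g * t⁻¹ * c = t * (g * (t⁻¹ * c * t)) * t⁻¹ := by group
      _ = c * (t * g * t⁻¹) := by rw [h1]; group

/-- Every element `h` of the normal closure of `x` is the value at `x` of a word map which depends
continuously on `x` and involves only conjugation by elements of a single member of a given
directed family of subgroups exhausting the group. -/
theorem exists_continuous_mem_closure_conj {ι : Type*} [Nonempty ι] {Λ : ι → Subgroup G}
    (hdir : Directed (· ≤ ·) Λ) (htop : ∀ g, ∃ i, g ∈ Λ i) {x h : G}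
    (hh : h ∈ Subgroup.normalClosure {x}) :
    ∃ (i : ι) (w : G → G), Continuous w ∧ w x = h ∧
      ∀ y, w y ∈ Subgroup.closure ((fun t => t * y * t⁻¹) '' (Λ i : Set G)) := by
  have hmono : ∀ {i j : ι}, Λ i ≤ Λ j → ∀ y,
      Subgroup.closure ((fun t => t * y * t⁻¹) '' (Λ i : Set G)) ≤
        Subgroup.closure ((fun t => t * y * t⁻¹) '' (Λ j : Set G)) :=
    fun hij y => Subgroup.closure_mono (Set.image_mono hij)
  induction hh using Subgroup.closure_induction with
  | mem h hh =>
    obtain ⟨_, rfl, hconj⟩ := Group.mem_conjugatesOfSet_iff.1 hh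
    obtain ⟨t, rfl⟩ := isConj_iff.1 hconj
    obtain ⟨i, hi⟩ := htop t
    exact ⟨i, fun y => t * y * t⁻¹, by fun_prop, rfl,
      fun y => Subgroup.subset_closure ⟨t, hi, rfl⟩⟩
  | one => exact ⟨Classical.arbitrary ι, fun _ => 1, continuous_const, rfl, fun y => one_mem _⟩
  | mul a b _ _ iha ihb =>
    obtain ⟨i, w, hw, rfl, hwi⟩ := iha
    obtain ⟨j, w', hw', rfl, hwj⟩ := ihb
    obtain ⟨k, hik, hjk⟩ := hdir i j
    exact ⟨k, fun y => w y * w' y, hw.mul hw', rfl,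
      fun y => mul_mem (hmono hik y (hwi y)) (hmono hjk y (hwj y))⟩
  | inv a _ iha =>
    obtain ⟨i, w, hw, rfl, hwi⟩ := iha
    exact ⟨i, fun y => (w y)⁻¹, hw.inv, rfl, fun y => inv_mem (hwi y)⟩

end Conjugates

/-! ### Abelian locally normal subgroups of a minimal closed normal subgroup -/

section AbelianLocallyNormal

variable {G : Type*} [Group G] [TopologicalSpace G] [IsTopologicalGroup G]

/-- A minimal closed normal subgroup `M` for which `M · C_G(M)` is dense contains no non-trivial
abelian subgroup `A` normalised by the compact open subgroup `U`. -/
theorem eq_bot_of_le_isMinimalClosedNormal [T2Space G] {S : Set G} {U : Subgroup G}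
    (hS : IsCompact S) (hUo : IsOpen (U : Set G)) (hUc : IsCompact (U : Set G))
    (hcore : CoreFree (Subgroup.closure S) U) (hQ : quasiCenter G = ⊥)
    {M : Subgroup G} (hM : IsMinimalClosedNormal M)
    (hd : Dense ((M ⊔ Subgroup.centralizer (M : Set G) : Subgroup G) : Set G))
    {A : Subgroup G} (hAM : A ≤ M) (hAU : A ≤ U) (hUA : U ≤ Subgroup.normalizer (A : Set G))
    (hcomm : ∀ a ∈ A, ∀ b ∈ A, a * b = b * a) : A = ⊥ := by
  classical
  by_contra hA
  have hMn : M.Normal := hM.1.1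
  have hAl : LocallyNormal A := LocallyNormal.of_le hUo hUA
  set Z := Subgroup.centralizer (M : Set G) with hZ
  have hZn : Z.Normal := Subgroup.normal_centralizer
  have hZM : ∀ z ∈ Z, ∀ m ∈ M, z * m = m * z :=
    fun z hz m hm => (Subgroup.mem_centralizer_iff.1 hz m hm).symm
  set N := Subgroup.normalClosure (A : Set G) with hN
  have hAN : A ≤ N := Subgroup.subset_normalClosure
  have hNM : N ≤ M := Subgroup.normalClosure_le_normal hAM
  have hNcl : N.topologicalClosure = M :=
    hM.topologicalClosure_eq (fun h => hA (le_bot_iff.1 (h ▸ hAN))) hNM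
  have hdN : Dense ((N ⊔ Z : Subgroup G) : Set G) := by
    have hle : M ⊔ Z ≤ (N ⊔ Z).topologicalClosure :=
      sup_le (hNcl ▸ Subgroup.topologicalClosure_mono le_sup_left)
        (le_sup_right.trans (Subgroup.le_topologicalClosure _))
    exact dense_closure.1 (hd.mono hle)
  -- `⟨S⟩` is contained in the group generated by `U`, `Z` and a finite subset `F` of `N`.
  obtain ⟨F, hF, hFN, hleF⟩ : ∃ F : Set G, F.Finite ∧ F ⊆ N ∧
      Subgroup.closure S ≤ U ⊔ Subgroup.closure F ⊔ Z := by
    obtain ⟨F₀, hF₀, hF₀N, hle⟩ := exists_finite_closure_le hS hUo hdN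
    have hdec : ∀ f ∈ F₀, ∃ n ∈ N, ∃ z ∈ Z, n * z = f :=
      fun f hf => Subgroup.mem_sup_of_normal_right.1 (hF₀N hf)
    choose! n hn z hz hnz using hdec
    refine ⟨n '' F₀, hF₀.image n, Set.image_subset_iff.2 hn, hle.trans ?_⟩
    refine sup_le (le_sup_left.trans le_sup_left) ((Subgroup.closure_le _).2 fun f hf => ?_)
    rw [← hnz f hf]
    exact mul_mem (Subgroup.mem_sup_left (Subgroup.mem_sup_right
      (Subgroup.subset_closure ⟨f, hf, rfl⟩))) (Subgroup.mem_sup_right (hz f hf))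
  obtain ⟨U', hU'o, -, hU'⟩ := exists_isOpen_forall_conj_mem hUo hF
  -- The open subgroups generated by `U`, `Z` and finitely many conjugates of `A` exhaust `G`.
  let Λ : Finset G → Subgroup G :=
    fun J => U ⊔ Z ⊔ Subgroup.closure (⋃ j ∈ J, (A.map (MulAut.conj j).toMonoidHom : Set G))
  have hΛmono : Monotone Λ := fun J J' h =>
    sup_le_sup_left (Subgroup.closure_mono (Set.biUnion_subset_biUnion_left h)) _
  have hΛdir : Directed (· ≤ ·) Λ := hΛmono.directed_le
  have hNΛ : ∀ g ∈ N, ∃ J, g ∈ Λ J := by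
    intro g hg
    rw [← Subgroup.mem_iSup_of_directed hΛdir]
    revert g
    refine (Subgroup.closure_le _).2 fun x hx => ?_
    obtain ⟨a, ha, hax⟩ := Group.mem_conjugatesOfSet_iff.1 hx
    obtain ⟨t, rfl⟩ := isConj_iff.1 hax
    refine (le_iSup Λ {t}) (Subgroup.mem_sup_right (Subgroup.subset_closure ?_))
    simp only [Finset.mem_singleton, Set.iUnion_iUnion_eq_left]
    exact ⟨a, ha, rfl⟩
  have hΛtop : ∀ g, ∃ J, g ∈ Λ J := by
    intro g
    obtain ⟨h, hh, hhg⟩ := exists_inv_mul_mem hUo (hdN g)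
    obtain ⟨n, hn, z, hz, rfl⟩ := Subgroup.mem_sup_of_normal_right.1 hh
    obtain ⟨J, hJ⟩ := hNΛ n hn
    refine ⟨J, ?_⟩
    have h1 := mul_mem (mul_mem hJ (Subgroup.mem_sup_left (Subgroup.mem_sup_right hz) : z ∈ Λ J))
      (Subgroup.mem_sup_left (Subgroup.mem_sup_left hhg) : _ ∈ Λ J)
    simpa [mul_assoc] using h1
  -- By compactness, finitely many conjugates suffice to recover `F` modulo `U` from any element
  -- `x` of `X`: the normal closure of `x` is dense in `M`.
  let X : Set G := ((M : Set G) ∩ U) \ U'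
  have hX : IsCompact X := (hUc.inter_left hM.1.2.1).diff hU'o
  let Q : Finset G → G → G → Prop := fun J f x =>
    ∃ h ∈ Subgroup.closure ((fun t => t * x * t⁻¹) '' (Λ J : Set G)), h⁻¹ * f ∈ U
  have hQmono : ∀ {J J'}, J ≤ J' → ∀ {f x}, Q J f x → Q J' f x := by
    rintro J J' hJ f x ⟨h, hh, hhf⟩
    exact ⟨h, Subgroup.closure_mono (Set.image_mono (hΛmono hJ)) hh, hhf⟩
  have hunif : ∀ f ∈ F, ∃ J, f ∈ Λ J ∧ ∀ x ∈ X, Q J f x := by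
    intro f hf
    obtain ⟨J₁, hJ₁⟩ := hΛtop f
    obtain ⟨J₂, hJ₂⟩ : ∃ J, ∀ x ∈ X, Q J f x := by
      refine hX.induction_on (p := fun s => ∃ J, ∀ x ∈ s, Q J f x) ⟨∅, by simp⟩
        (fun s t hst ⟨J, hJ⟩ => ⟨J, fun x hx => hJ x (hst hx)⟩) ?_ ?_
      · rintro s t ⟨J, hJ⟩ ⟨J', hJ'⟩
        refine ⟨J ∪ J', ?_⟩
        rintro x (hx | hx)
        · exact hQmono Finset.subset_union_left (hJ x hx)
        · exact hQmono Finset.subset_union_right (hJ' x hx)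
      · rintro x ⟨⟨hxM, hxU⟩, hxU'⟩
        have hxN : Subgroup.normalClosure {x} ≤ M :=
          Subgroup.normalClosure_le_normal (Set.singleton_subset_iff.2 hxM)
        have hx1 : Subgroup.normalClosure {x} ≠ ⊥ := by
          intro h
          have := Subgroup.subset_normalClosure (s := {x}) rfl
          rw [SetLike.mem_coe, h, Subgroup.mem_bot] at this
          exact hxU' (this ▸ one_mem U')
        have hcl := hM.topologicalClosure_eq hx1 hxN
        have hfcl : f ∈ (Subgroup.normalClosure {x}).topologicalClosure := hcl ▸ hNM (hFN hf)
        obtain ⟨h, hh, hhf⟩ := exists_inv_mul_mem hUo hfcl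
        obtain ⟨J, w, hw, rfl, hwJ⟩ := exists_continuous_mem_closure_conj hΛdir hΛtop hh
        have hev : ∀ᶠ y in 𝓝 x, (w y)⁻¹ * f ∈ U :=
          (hw.inv.mul continuous_const).continuousAt.eventually_mem (hUo.mem_nhds hhf)
        exact ⟨_, mem_nhdsWithin_of_mem_nhds hev, J, fun y hy => ⟨w y, hwJ y, hy⟩⟩
    exact ⟨J₁ ∪ J₂, hΛmono Finset.subset_union_left hJ₁,
      fun x hx => hQmono Finset.subset_union_right (hJ₂ x hx)⟩
  obtain ⟨J, hJF, hJX⟩ : ∃ J, F ⊆ Λ J ∧ ∀ f ∈ F, ∀ x ∈ X, Q J f x := by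
    choose! j hj hjX using hunif
    have hle : ∀ f ∈ F, j f ≤ hF.toFinset.sup j :=
      fun f hf => Finset.le_sup (f := j) (hF.mem_toFinset.2 hf)
    exact ⟨hF.toFinset.sup j, fun f hf => hΛmono (hle f hf) (hj f hf),
      fun f hf x hx => hQmono (hle f hf) (hjX f hf x hx)⟩
  -- The finite set of all `U`-conjugates of the chosen conjugates of `A`.
  let 𝒜 : Set (Subgroup G) := ⋃ j ∈ J, (fun u : G =>
    (A.map (MulAut.conj j).toMonoidHom).map (MulAut.conj u).toMonoidHom) '' (U : Set G)
  have h𝒜 : 𝒜.Finite := J.finite_toSet.biUnion fun j _ => (hAl.map_conj j).finite_conj hUc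
  have h𝒜l : ∀ B ∈ 𝒜, LocallyNormal B := by
    intro B hB
    obtain ⟨j, _, u, _, rfl⟩ := Set.mem_iUnion₂.1 hB
    exact (hAl.map_conj j).map_conj u
  have h𝒜c : ∀ B ∈ 𝒜, ∀ a ∈ B, ∀ b ∈ B, a * b = b * a := by
    intro B hB
    obtain ⟨j, _, u, _, rfl⟩ := Set.mem_iUnion₂.1 hB
    rintro _ ⟨_, ⟨a, ha, rfl⟩, rfl⟩ _ ⟨_, ⟨b, hb, rfl⟩, rfl⟩
    rw [← map_mul, ← map_mul, ← map_mul, ← map_mul, hcomm a ha b hb]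
  have h𝒜U : ∀ u ∈ U, ∀ B ∈ 𝒜, B.map (MulAut.conj u).toMonoidHom ∈ 𝒜 := by
    intro u hu B hB
    obtain ⟨j, hj, v, hv, rfl⟩ := Set.mem_iUnion₂.1 hB
    refine Set.mem_iUnion₂.2 ⟨j, hj, u * v, mul_mem hu hv, ?_⟩
    simp only [Subgroup.map_map]
    congr 1
    ext x
    simp [mul_assoc]
  have hJ𝒜 : ∀ j ∈ J, A.map (MulAut.conj j).toMonoidHom ∈ 𝒜 := by
    intro j hj
    refine Set.mem_iUnion₂.2 ⟨j, hj, 1, one_mem U, ?_⟩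
    ext x
    simp
  -- An open normal subgroup `V` of `U` normalising all these conjugates.
  obtain ⟨V, hVo, hVU, hUV, hV𝒜⟩ : ∃ V : Subgroup G, IsOpen (V : Set G) ∧ V ≤ U ∧
      U ≤ Subgroup.normalizer (V : Set G) ∧ ∀ B ∈ 𝒜, V ≤ Subgroup.normalizer (B : Set G) := by
    have hV₀ : IsOpen ((⨅ B ∈ 𝒜, Subgroup.normalizer (B : Set G) : Subgroup G) : Set G) := by
      rw [Subgroup.coe_iInf]
      simp only [Subgroup.coe_iInf]
      exact h𝒜.isOpen_biInter h𝒜l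
    obtain ⟨V, hVo, hV, hVU, hUV⟩ := exists_isOpen_le_normalizer hUc hUo hV₀
    exact ⟨V, hVo, hVU, hUV, fun B hB => hV.trans (iInf₂_le B hB)⟩
  let K : Subgroup G :=
    (A ⊓ V) ⊓ ⨅ B ∈ 𝒜, Subgroup.centralizer ((B ⊓ V : Subgroup G) : Set G)
  have hK𝒜 : ∀ k ∈ K, ∀ B ∈ 𝒜, ∀ b ∈ B, b ∈ V → k * b = b * k := by
    intro k hk B hB b hb hbV
    have := (Subgroup.mem_iInf.1 ((Subgroup.mem_iInf.1 hk.2) B)) hB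
    exact (Subgroup.mem_centralizer_iff.1 this b ⟨hb, hbV⟩).symm
  have hKA : K ≤ A := inf_le_left.trans inf_le_left
  have hK1 : K ≠ ⊥ := by
    obtain ⟨K', hK'A, hK'1, -, hK'⟩ := exists_le_forall_comm h𝒜 hV𝒜 h𝒜c
      (inf_le_right : A ⊓ V ≤ V) (le_normalizer_inf (hVU.trans hUA) Subgroup.le_normalizer)
      (hAl.inf_ne_bot hQ hA hVo)
    have hK'K : K' ≤ K := by
      refine le_inf hK'A (le_iInf₂ fun B hB k hk => Subgroup.mem_centralizer_iff.2 ?_)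
      exact fun b hb => (hK' B hB b hb.1 hb.2 k hk).symm
    exact fun h => hK'1 (le_bot_iff.1 (h ▸ hK'K))
  have hUK : U ≤ Subgroup.normalizer (K : Set G) := by
    refine le_normalizer_inf (le_normalizer_inf hUA hUV) ?_
    rw [Subgroup.le_normalizer_iff]
    intro u hu k hk
    rw [Subgroup.mem_iInf]
    intro B
    rw [Subgroup.mem_iInf]
    intro hB
    refine Subgroup.mem_centralizer_iff.2 fun b hb => ?_
    have h1 := (Subgroup.mem_iInf.1 ((Subgroup.mem_iInf.1 hk) _)) (h𝒜U u⁻¹ (inv_mem hu) B hB)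
    have h2 := Subgroup.mem_centralizer_iff.1 h1 (u⁻¹ * b * u)
      ⟨⟨b, hb.1, by simp⟩, by
        simpa using (Subgroup.le_normalizer_iff.1 hUV) u⁻¹ (inv_mem hu) b hb.2⟩
    calc b * (u * k * u⁻¹) = u * (u⁻¹ * b * u * k) * u⁻¹ := by group
      _ = u * k * u⁻¹ * b := by rw [h2]; group
  have hKl : LocallyNormal K := LocallyNormal.of_le hUo hUK
  set C := Subgroup.centralizer (K : Set G) with hC
  let L : Subgroup G := quasiCentralizer C
  have hKL : K ≤ L := fun k hk => ⟨⊤, isOpen_univ, fun c hc _ =>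
    Subgroup.mem_centralizer_iff.1 hc k hk⟩
  have hKC : K ≤ C := fun k hk => Subgroup.mem_centralizer_iff.2 fun k' hk' =>
    hcomm k' (hKA hk') k (hKA hk)
  have hZC : Z ≤ C := Subgroup.centralizer_le (hKA.trans hAM)
  -- `U` and `Z` normalise `C`. An element `t` of a conjugate `B ∈ 𝒜` satisfies `[c, t] ∈ B ∩ V ≤ C`
  -- for all small `c ∈ C`.
  have hUL : U ≤ Subgroup.normalizer (L : Set G) := by
    rw [Subgroup.le_normalizer_iff]
    intro u hu g hg
    refine conj_mem_quasiCentralizer (V := ⊤) isOpen_univ (fun c hc _ => ?_) hg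
    refine Subgroup.mem_centralizer_iff.2 fun k hk => ?_
    have h1 := Subgroup.mem_centralizer_iff.1 hc _ ((Subgroup.le_normalizer_iff.1 hUK) u hu k hk)
    calc k * (u⁻¹ * c * u) = u⁻¹ * (u * k * u⁻¹ * c) * u := by group
      _ = u⁻¹ * c * u * k := by rw [h1]; group
  have hZL : Z ≤ Subgroup.normalizer (L : Set G) := by
    rw [Subgroup.le_normalizer_iff]
    intro z hz g hg
    exact conj_mem_quasiCentralizer (V := ⊤) isOpen_univ
      (fun c hc _ => mul_mem (mul_mem (inv_mem (hZC hz)) hc) (hZC hz)) hg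
  have hBL : ∀ B ∈ 𝒜, B ≤ Subgroup.normalizer (L : Set G) := by
    intro B hB
    rw [Subgroup.le_normalizer_iff]
    intro t ht g hg
    obtain ⟨V', hV'o, hV', hV'U⟩ : ∃ V' : Subgroup G, IsOpen (V' : Set G) ∧ V' ≤ V ∧
        ∀ v ∈ V', t⁻¹ * v * t⁻¹⁻¹ ∈ V := by
      obtain ⟨V', hV'o, hV', h⟩ := exists_isOpen_forall_conj_mem hVo (Set.finite_singleton t)
      exact ⟨V', hV'o, hV', fun v hv => by simpa using (h t rfl v hv).2⟩
    refine conj_mem_quasiCentralizer hV'o (fun c hc hcV' => ?_) hg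
    have hcB : c⁻¹ * (t⁻¹ * c * t) ∈ B := by
      have h1 := (Subgroup.le_normalizer_iff.1 (hV𝒜 B hB)) c⁻¹ (inv_mem (hV' hcV')) t⁻¹
        (inv_mem ht)
      simpa [mul_assoc] using mul_mem h1 ht
    have hcV : c⁻¹ * (t⁻¹ * c * t) ∈ V :=
      mul_mem (inv_mem (hV' hcV')) (by simpa using hV'U c hcV')
    have hcC : c⁻¹ * (t⁻¹ * c * t) ∈ C :=
      Subgroup.mem_centralizer_iff.2 fun k hk => hK𝒜 k hk B hB _ hcB hcV
    simpa using mul_mem hc hcC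
  have hΛL : Λ J ≤ Subgroup.normalizer (L : Set G) := by
    refine sup_le (sup_le hUL hZL) ((Subgroup.closure_le _).2 (Set.iUnion₂_subset fun j hj => ?_))
    exact hBL _ (hJ𝒜 j hj)
  have hMtop : ∀ H : Subgroup G, H ≤ Subgroup.normalizer (M : Set G) := fun H => by
    rw [Subgroup.normalizer_eq_top M]
    exact le_top
  by_cases hcase : (L ⊓ M) ⊓ U ≤ U'
  · have hULM : U ⊔ Subgroup.closure F ≤
        Subgroup.normalizer (((L ⊓ M) ⊓ U : Subgroup G) : Set G) :=
      sup_closure_le_normalizer_inf hU' (le_normalizer_inf hUL (hMtop U))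
        (fun f hf => le_normalizer_inf hΛL (hMtop _) (hJF hf)) hcase
    have hZLM : Z ≤ Subgroup.normalizer (((L ⊓ M) ⊓ U : Subgroup G) : Set G) :=
      fun z hz => mem_normalizer_of_forall_comm fun e he => hZM z hz e he.1.2
    have hbot := hcore _ inf_le_right (hleF.trans (sup_le hULM hZLM))
    exact hK1 (le_bot_iff.1 (hbot ▸ le_inf (le_inf hKL (hKA.trans hAM)) (hKA.trans hAU)))
  · obtain ⟨x, ⟨⟨hxL, hxM⟩, hxU⟩, hxU'⟩ := SetLike.not_le_iff_exists.1 hcase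
    have hfac : ∀ f ∈ F, ∃ l ∈ L, l⁻¹ * f ∈ U := by
      intro f hf
      obtain ⟨l, hl, hlf⟩ := hJX f hf x ⟨⟨hxM, hxU⟩, hxU'⟩
      refine ⟨l, (Subgroup.closure_le L).2 ?_ hl, hlf⟩
      rintro _ ⟨t, ht, rfl⟩
      exact (Subgroup.mem_normalizer_iff.1 (hΛL ht) x).1 hxL
    choose! l hl hlf using hfac
    obtain ⟨V₁, hV₁, hV₁F⟩ := exists_isOpen_forall_comm (E := C) (hF.image l)
      (Set.image_subset_iff.2 hl)
    obtain ⟨V₂, hV₂, hV₂V₁, hV₂U, hUV₂⟩ := exists_isOpen_le_normalizer hUc hUo hV₁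
    have hUE := le_normalizer_inf hUK hUV₂
    refine hKl.inf_ne_bot hQ hK1 hV₂ (hcore _ (inf_le_right.trans hV₂U) (hleF.trans ?_))
    refine sup_le (sup_le hUE ((Subgroup.closure_le _).2 fun f hf => ?_)) fun z hz => ?_
    · have h1 : l f ∈ Subgroup.normalizer ((K ⊓ V₂ : Subgroup G) : Set G) :=
        mem_normalizer_of_forall_comm fun e he =>
          hV₁F _ ⟨f, hf, rfl⟩ e (hKC he.1) (hV₂V₁ he.2)
      have h2 := mul_mem h1 (hUE (hlf f hf))
      simpa using h2
    · exact mem_normalizer_of_forall_comm fun e he => hZM z hz e (hAM (hKA he.1))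

end AbelianLocallyNormal

/-! ### Topologically characteristically simple groups -/

section CharacteristicallySimple

variable {G : Type*} [Group G] [TopologicalSpace G]

theorem TopologicallySimple.topologicallyCharacteristicallySimple [IsTopologicalGroup G]
    (h : TopologicallySimple G) : TopologicallyCharacteristicallySimple G := by
  refine ⟨h.1, fun N hN hφ => h.2 N ⟨fun n hn g => ?_⟩ hN⟩
  let φ : G ≃ₜ* G :=
    { MulAut.conj g with
      continuous_toFun := by
        change Continuous fun x : G => g * x * g⁻¹
        fun_prop
      continuous_invFun := by
        change Continuous fun x : G => g⁻¹ * x * g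
        fun_prop }
  exact hφ φ ▸ Subgroup.mem_map_of_mem (φ : G →* G) hn

theorem TopologicallyCharacteristicallySimple.dense [IsTopologicalGroup G]
    (h : TopologicallyCharacteristicallySimple G) {H : Subgroup G} (hH1 : H ≠ ⊥)
    (hH : ∀ φ : G ≃ₜ* G, H.map (φ : G →* G) ≤ H) : Dense (H : Set G) := by
  have hle : ∀ φ : G ≃ₜ* G,
      H.topologicalClosure.map (φ : G →* G) ≤ H.topologicalClosure := by
    rintro φ _ ⟨x, hx, rfl⟩
    refine map_mem_closure φ.continuous hx fun y hy => hH φ ⟨y, hy, rfl⟩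
  have heq : ∀ φ : G ≃ₜ* G,
      H.topologicalClosure.map (φ : G →* G) = H.topologicalClosure := fun φ =>
    le_antisymm (hle φ) fun x hx => ⟨φ.symm x, hle φ.symm ⟨x, hx, rfl⟩, φ.apply_symm_apply x⟩
  rcases h.2 _ H.isClosed_topologicalClosure heq with h1 | h1
  · exact absurd (le_bot_iff.1 (h1 ▸ H.le_topologicalClosure)) hH1
  · intro x
    have : x ∈ H.topologicalClosure := h1 ▸ Subgroup.mem_top x
    exact this

theorem TopologicallyCharacteristicallySimple.aSemisimple [IsTopologicalGroup G] [T2Space G]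
    (h : TopologicallyCharacteristicallySimple G) (hdisc : ¬ DiscreteTopology G)
    (hexp : RegionallyExpansive G) : ASemisimple G := by
  have hnt : Nontrivial G := h.1
  obtain ⟨S, W, hS, hWo, hWc, -, hcore⟩ := hexp.exists_coreFree
  have hQ : quasiCenter G = ⊥ := by
    by_contra hQ
    rw [← quasiCentralizer_top] at hQ
    refine not_dense_quasiCentralizer hS hWo hWc hcore (E := ⊤) ?_ ?_ (h.dense hQ fun φ => ?_)
    · rw [Subgroup.normalizer_eq_top]
      exact le_top
    · intro V hV hbot
      rw [top_inf_eq] at hbot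
      refine hdisc (discreteTopology_of_isOpen_singleton_one ?_)
      rwa [hbot] at hV
    · have := map_quasiCentralizer_le ⊤ φ
      rwa [Subgroup.map_top_of_surjective _ φ.surjective] at this
  refine ⟨fun A hA hAc => ?_, hQ⟩
  by_contra hA1
  obtain ⟨M₀, hM₀⟩ := exists_isMinimalClosedNormal hS hWo hWc hcore hQ
  -- Otherwise `A` quasi-centralises all the images of `M₀` under automorphisms.
  obtain ⟨φ₀, hφ₀⟩ : ∃ φ : G ≃ₜ* G, A ⊓ M₀.map (φ : G →* G) ≠ ⊥ := by
    by_contra! hne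
    let R : Subgroup G := ⨅ φ : G ≃ₜ* G, quasiCentralizer (M₀.map (φ : G →* G))
    have hAR : A ≤ R := le_iInf fun φ =>
      have := (hM₀.map φ).1.1
      le_quasiCentralizer_of_inf_eq_bot hA (hne φ)
    have hRd : Dense (R : Set G) := by
      refine h.dense (fun hb => hA1 (le_bot_iff.1 (hb ▸ hAR))) fun ψ => ?_
      rintro _ ⟨r, hr, rfl⟩
      refine Subgroup.mem_iInf.2 fun φ => ?_
      have h1 := map_quasiCentralizer_le _ ψ
        ⟨r, Subgroup.mem_iInf.1 hr (φ.trans ψ.symm), rfl⟩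
      have h2 : (M₀.map ((φ.trans ψ.symm : G ≃ₜ* G) : G →* G)).map (ψ : G →* G) =
          M₀.map (φ : G →* G) := by
        rw [Subgroup.map_map]
        congr 1
        ext x
        simp
      rwa [h2] at h1
    have hn := hM₀.1.1
    refine not_dense_quasiCentralizer hS hWo hWc hcore (E := M₀) ?_ (fun V hV => ?_)
      (hRd.mono fun r hr => ?_)
    · rw [Subgroup.normalizer_eq_top]
      exact le_top
    · refine LocallyNormal.inf_ne_bot hQ ?_ hM₀.1.2.2 hV
      simp [LocallyNormal, Subgroup.normalizer_eq_top]
    · have := Subgroup.mem_iInf.1 hr (ContinuousMulEquiv.refl G)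
      rwa [show M₀.map ((ContinuousMulEquiv.refl G : G ≃ₜ* G) : G →* G) = M₀ from
        Subgroup.map_id M₀] at this
  set M := M₀.map (φ₀ : G →* G) with hMdef
  have hM : IsMinimalClosedNormal M := hM₀.map φ₀
  have hMn : M.Normal := hM.1.1
  have hMd : Dense ((M ⊔ Subgroup.centralizer (M : Set G) : Subgroup G) : Set G) := by
    have hP : Dense ((⨆ φ : G ≃ₜ* G, M.map (φ : G →* G) : Subgroup G) : Set G) := by
      refine h.dense (fun hb => ?_) fun ψ => ?_
      · have h1 := le_iSup (fun φ : G ≃ₜ* G => M.map (φ : G →* G)) (ContinuousMulEquiv.refl G)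
        rw [hb, le_bot_iff] at h1
        exact hM.1.2.2 ((Subgroup.map_id M).symm.trans h1)
      · rw [Subgroup.map_iSup]
        refine iSup_le fun φ => ?_
        refine le_trans (le_of_eq ?_)
          (le_iSup (fun φ : G ≃ₜ* G => M.map (φ : G →* G)) (φ.trans ψ))
        rw [Subgroup.map_map]
        rfl
    have hle : (⨆ φ : G ≃ₜ* G, M.map (φ : G →* G)) ≤ M ⊔ Subgroup.centralizer (M : Set G) :=
      iSup_le fun φ => hM.le_sup_centralizer (hM.map φ)
    exact hP.mono hle
  -- Shrinking `W`, the compact open subgroup may be assumed to normalise `A`.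
  set U := W ⊓ Subgroup.normalizer (A : Set G) with hU
  have hUo : IsOpen (U : Set G) := hWo.inter hA
  have hUc : IsCompact (U : Set G) := hWc.inter_right (Subgroup.isClosed_of_isOpen _ hA)
  have hUM : U ≤ Subgroup.normalizer (M : Set G) := by
    rw [Subgroup.normalizer_eq_top]
    exact le_top
  have hUAM : U ≤ Subgroup.normalizer ((A ⊓ M : Subgroup G) : Set G) :=
    le_normalizer_inf inf_le_right hUM
  refine (LocallyNormal.of_le hUo hUAM).inf_ne_bot hQ hφ₀ hUo ?_
  refine eq_bot_of_le_isMinimalClosedNormal hS hUo hUc (hcore.mono inf_le_left) hQ hM hMd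
    (inf_le_left.trans inf_le_right) inf_le_right
    (le_normalizer_inf hUAM Subgroup.le_normalizer) fun a ha b hb => ?_
  exact congrArg Subtype.val (hAc.is_comm.comm ⟨a, ha.1.1⟩ ⟨b, hb.1.1⟩)

end CharacteristicallySimple

/-! ### Monolithic groups -/

section RobustlyMonolithic

variable {G : Type*} [Group G] [TopologicalSpace G]

theorem normal_monolith : (monolith G).Normal :=
  ⟨fun n hn g => Subgroup.mem_sInf.2 fun N hN =>
    hN.1.conj_mem n (Subgroup.mem_sInf.1 hn N hN) g⟩

variable [IsTopologicalGroup G]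

/-- If the monolith has trivial quasi-centre, then its quasi-centraliser is trivial as well: it
intersects the monolith trivially, hence centralises it, whereas a non-trivial centraliser would
contain the monolith. -/
theorem quasiCentralizer_monolith_eq_bot [T2Space G] (hmon : Monolithic G)
    (hQ : quasiCenter (monolith G) = ⊥) : quasiCentralizer (monolith G) = ⊥ := by
  set M := monolith G with hM
  have hMn : M.Normal := normal_monolith
  set R := quasiCentralizer M with hR
  have hRn : R.Normal := by
    refine ⟨fun r hr g => conj_mem_quasiCentralizer (V := ⊤) isOpen_univ (fun m hm _ => ?_) hr⟩
    simpa using hMn.conj_mem m hm g⁻¹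
  have hRM : R ⊓ M = ⊥ := by
    refine (Subgroup.eq_bot_iff_forall _).2 ?_
    rintro x ⟨⟨V, hV, hx⟩, hxM⟩
    have h1 : (⟨x, hxM⟩ : M) ∈ quasiCenter M := by
      refine Subgroup.isOpen_mono (H₁ := V.subgroupOf M) (fun m hm => ?_)
        (hV.preimage continuous_subtype_val)
      exact Subgroup.mem_centralizer_singleton_iff.2 (Subtype.ext (hx m m.2 hm).symm)
    rw [hQ, Subgroup.mem_bot] at h1
    exact congrArg Subtype.val h1
  by_contra hR1
  have hRZ : R ≤ Subgroup.centralizer (M : Set G) := fun r hr =>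
    Subgroup.mem_centralizer_iff.2 fun m hm =>
      (Subgroup.commute_of_normal_of_disjoint R M hRn hMn (disjoint_iff.2 hRM) r m hr hm).symm
  have hMZ : M ≤ Subgroup.centralizer (M : Set G) := by
    refine sInf_le ⟨Subgroup.normal_centralizer, ?_, fun hb => hR1 (le_bot_iff.1 (hb ▸ hRZ))⟩
    exact Set.isClosed_centralizer (M : Set G)
  have hMR : M ≤ R := fun m hm => ⟨⊤, isOpen_univ, fun e he _ =>
    (Subgroup.mem_centralizer_iff.1 (hMZ hm) e he).symm⟩
  rw [inf_eq_right.2 hMR] at hRM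
  exact hmon hRM

theorem aSemisimple_of_monolith [T2Space G] (hmon : Monolithic G)
    (hss : ASemisimple (monolith G)) : ASemisimple G := by
  have hR := quasiCentralizer_monolith_eq_bot hmon hss.2
  have hMn : (monolith G).Normal := normal_monolith
  refine ⟨fun A hA hAc => ?_, ?_⟩
  · have hbot : A.subgroupOf (monolith G) = ⊥ := by
      refine hss.1 _ ?_ ⟨⟨fun a b => ?_⟩⟩
      · refine Subgroup.isOpen_mono
          (H₁ := (Subgroup.normalizer (A : Set G)).subgroupOf (monolith G)) ?_
          (hA.preimage continuous_subtype_val)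
        rw [Subgroup.le_normalizer_iff]
        exact fun g hg a ha => (Subgroup.mem_normalizer_iff.1 (Subgroup.mem_subgroupOf.1 hg) _).1 ha
      · have h1 := congrArg Subtype.val (hAc.is_comm.comm ⟨a.1.1, a.2⟩ ⟨b.1.1, b.2⟩)
        exact Subtype.ext (Subtype.ext h1)
    rw [Subgroup.subgroupOf_eq_bot, disjoint_iff] at hbot
    exact le_bot_iff.1 (hR ▸ le_quasiCentralizer_of_inf_eq_bot hA hbot)
  · exact le_bot_iff.1 (hR ▸ quasiCenter_le_quasiCentralizer _)

theorem regionallyExpansive_of_monolith [T2Space G] [LocallyCompactSpace G]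
    [TotallyDisconnectedSpace G] (hmon : Monolithic G) (hQ : quasiCenter (monolith G) = ⊥)
    (hexp : RegionallyExpansive (monolith G)) : RegionallyExpansive G := by
  have hMn : (monolith G).Normal := normal_monolith
  obtain ⟨S, W, hS, hWo, -, -, hcore⟩ := hexp.exists_coreFree
  obtain ⟨T, hT, hTW⟩ := isOpen_induced_iff.1 hWo
  have h1T : (1 : G) ∈ T := by
    have : (1 : monolith G) ∈ (↑) ⁻¹' T := hTW ▸ one_mem W
    exact this
  obtain ⟨U, hUo, hUc, hUT⟩ := exists_compact_open_subgroup (hT.mem_nhds h1T)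
  refine regionallyExpansive_of_coreFree (S := (↑) '' S ∪ U) (W := U)
    ((hS.image continuous_subtype_val).union hUc) hUo hUc
    (fun u hu => Subgroup.subset_closure (Or.inr hu)) fun E hEU hE => ?_
  have hEl : LocallyNormal E := LocallyNormal.of_le hUo
    (le_trans (fun u hu => Subgroup.subset_closure (Or.inr hu)) hE)
  have hEM : E.subgroupOf (monolith G) = ⊥ := by
    refine hcore _ (fun e he => ?_) ?_
    · have h1 : e ∈ (↑) ⁻¹' T := hUT (hEU he)
      rw [hTW] at h1
      exact h1
    · refine (Subgroup.closure_le _).2 fun s hs => ?_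
      have h1 : (s : G) ∈ Subgroup.normalizer (E : Set G) :=
        hE (Subgroup.subset_closure (Or.inl ⟨s, hs, rfl⟩))
      exact Subgroup.mem_normalizer_iff.2 fun e => Subgroup.mem_normalizer_iff.1 h1 e
  rw [Subgroup.subgroupOf_eq_bot, disjoint_iff] at hEM
  exact le_bot_iff.1 (quasiCentralizer_monolith_eq_bot hmon hQ ▸
    le_quasiCentralizer_of_inf_eq_bot hEl hEM)

end RobustlyMonolithic

end TDLC

theorem mainTheorem8 (G : Type*) [Group G] [TopologicalSpace G] [IsTopologicalGroup G]
    [T2Space G] [LocallyCompactSpace G] [TotallyDisconnectedSpace G] :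
    (TDLC.RobustlyMonolithic G → TDLC.RegionallyExpansive G ∧ TDLC.ASemisimple G) ∧
    (¬ DiscreteTopology G → TDLC.RegionallyExpansive G →
      TDLC.TopologicallyCharacteristicallySimple G → TDLC.ASemisimple G) := by
  refine ⟨fun ⟨hmon, hdisc, hexp, hsimple⟩ => ?_, fun hdisc hexp h => h.aSemisimple hdisc hexp⟩
  have hss : TDLC.ASemisimple (TDLC.monolith G) :=
    hsimple.topologicallyCharacteristicallySimple.aSemisimple hdisc hexp
  exact ⟨TDLC.regionallyExpansive_of_monolith hmon hss.2 hexp,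
    TDLC.aSemisimple_of_monolith hmon hss⟩
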